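/- Let $A$ be a separable prime C*-algebra, where prime means that $A\neq 0$ and that $IJ\neq 0$ for any two nonzero closed two-sided ideals $I,J\subseteq A$. Let $G$ be a Hausdorff topological group. An action of $G$ on $A$ is a homomorphism $\alpha\colon G\to\mathrm{Aut}(A)$ into the group of *-automorphisms of $A$ such that $g\mapsto\alpha_g(a)$ is norm continuous for every $a\in A$; it is called minimal if $0$ and $A$ are the only closed two-sided ideals $J$ of $A$ with $\alpha_g(J)\subseteq J$ for all $g\in G$. Let $\mathrm{Prim}(A)$ be the set of primitive ideals of $A$, that is, of kernels of irreducible *-representations of $A$ on Hilbert spaces. (1) Let $\alpha\colon G\to\mathrm{Aut}(A)$ be a minimal action, and let $$H=\{g\in G : \alpha_g(P)=P \text{ for all } P\in\mathrm{Prim}(A)\}$$ be the subgroup of the elements of $G$ that act trivially on $\mathrm{Prim}(A)$. If $G/H$ is compact in the quotient topology, then $A$ is simple, that is, $0$ and $A$ are its only closed two-sided ideals. (2) In particular, if $G$ is compact and $A$ is not simple, then there is no minimal action of $G$ on $A$. -/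

import Mathlib

open scoped Topology

universe u v

namespace CStarMin

section Ideals

variable {A : Type u} [NonUnitalCStarAlgebra A]

/-- Ideals of a C*-algebra are, as usual, norm-closed two-sided ideals. -/
structure IsClosedIdeal (J : Submodule ℂ A) : Prop where
  mul_mem_left : ∀ (a : A) {x : A}, x ∈ J → a * x ∈ J
  mul_mem_right : ∀ (a : A) {x : A}, x ∈ J → x * a ∈ J
  isClosed : IsClosed (J : Set A)

/-- A *-representation `π` of `A` on a Hilbert space `E` is (topologically) irreducible if it is
nonzero and `{0}` and `E` are the only closed `π(A)`-invariant subspaces. -/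
structure IsIrreducibleRep {E : Type u} [NormedAddCommGroup E] [InnerProductSpace ℂ E]
    [CompleteSpace E] (π : A →⋆ₙₐ[ℂ] (E →L[ℂ] E)) : Prop where
  ne_zero : ∃ a, π a ≠ 0
  eq_bot_or_eq_top : ∀ K : Submodule ℂ E, IsClosed (K : Set E) →
    (∀ a, ∀ x ∈ K, π a x ∈ K) → K = ⊥ ∨ K = ⊤

/-- A primitive ideal is the kernel of an irreducible *-representation on a Hilbert space.
(Such a representation is cyclic, so a Hilbert space in the universe of `A` is no restriction.) -/
def IsPrimitiveIdeal (J : Submodule ℂ A) : Prop :=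
  ∃ (E : Type u) (_ : NormedAddCommGroup E) (_ : InnerProductSpace ℂ E) (_ : CompleteSpace E)
    (π : A →⋆ₙₐ[ℂ] (E →L[ℂ] E)), IsIrreducibleRep π ∧ ∀ a, a ∈ J ↔ π a = 0

/-- The direct image `φ(J)` under an automorphism `φ`. -/
def image (φ : A ≃⋆ₐ[ℂ] A) (J : Submodule ℂ A) : Submodule ℂ A where
  carrier := φ '' J
  add_mem' := by
    rintro _ _ ⟨x, hx, rfl⟩ ⟨y, hy, rfl⟩
    exact ⟨x + y, J.add_mem hx hy, map_add φ x y⟩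
  zero_mem' := ⟨0, J.zero_mem, map_zero φ⟩
  smul_mem' := by
    rintro c _ ⟨x, hx, rfl⟩
    exact ⟨c • x, J.smul_mem c hx, map_smul φ c x⟩

theorem mem_image (φ : A ≃⋆ₐ[ℂ] A) (J : Submodule ℂ A) (y : A) :
    y ∈ image φ J ↔ ∃ x ∈ J, φ x = y := Iff.rfl

theorem mem_image_iff_symm (φ : A ≃⋆ₐ[ℂ] A) (J : Submodule ℂ A) (y : A) :
    y ∈ image φ J ↔ φ.symm y ∈ J := by
  rw [mem_image]
  constructor
  · rintro ⟨x, hx, rfl⟩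
    simpa using hx
  · intro h
    exact ⟨_, h, by simp⟩

theorem IsPrimitiveIdeal.image {J : Submodule ℂ A} (hJ : IsPrimitiveIdeal J)
    (φ : A ≃⋆ₐ[ℂ] A) : IsPrimitiveIdeal (image φ J) := by
  obtain ⟨E, i₁, i₂, i₃, π, hπ, hker⟩ := hJ
  refine ⟨E, i₁, i₂, i₃, π.comp (φ.symm : A →⋆ₙₐ[ℂ] A), ⟨?_, ?_⟩, ?_⟩
  · obtain ⟨a, ha⟩ := hπ.ne_zero
    exact ⟨φ a, by simpa using ha⟩
  · intro K hK hinv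
    refine hπ.eq_bot_or_eq_top K hK fun a x hx => ?_
    simpa using hinv (φ a) x hx
  · intro a
    rw [mem_image_iff_symm, hker]
    rfl

variable (A) in
/-- A prime C*-algebra: `A ≠ 0`, and `IJ = 0` for closed ideals `I`, `J` only if `I = 0` or
`J = 0`. -/
structure IsPrimeCStar : Prop where
  nontrivial : Nontrivial A
  eq_bot_or_eq_bot : ∀ I J : Submodule ℂ A, IsClosedIdeal I → IsClosedIdeal J →
    (∀ x ∈ I, ∀ y ∈ J, x * y = 0) → I = ⊥ ∨ J = ⊥

variable (A) in
/-- A simple C*-algebra: `A ≠ 0`, and `0` and `A` are its only closed ideals. -/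
structure IsSimpleCStar : Prop where
  nontrivial : Nontrivial A
  eq_bot_or_eq_top : ∀ J : Submodule ℂ A, IsClosedIdeal J → J = ⊥ ∨ J = ⊤

variable (A) in
/-- The (underlying set of the) primitive ideal space of `A`. -/
def Prim : Type u := {J : Submodule ℂ A // IsPrimitiveIdeal J}

/-- The map `Prim(φ) : Prim(A) → Prim(A)`, `J ↦ φ(J)`. -/
def Prim.map (φ : A ≃⋆ₐ[ℂ] A) (P : Prim A) : Prim A := ⟨image φ P.1, P.2.image φ⟩

theorem Prim.map_one (P : Prim A) : Prim.map 1 P = P :=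
  Subtype.ext <| Submodule.ext fun x => by
    change x ∈ CStarMin.image 1 P.1 ↔ x ∈ P.1
    rw [mem_image_iff_symm]
    rfl

theorem Prim.map_mul (φ ψ : A ≃⋆ₐ[ℂ] A) (P : Prim A) :
    Prim.map (φ * ψ) P = Prim.map φ (Prim.map ψ P) :=
  Subtype.ext <| Submodule.ext fun x => by
    change x ∈ CStarMin.image (φ * ψ) P.1 ↔ x ∈ CStarMin.image φ (CStarMin.image ψ P.1)
    rw [mem_image_iff_symm, mem_image_iff_symm, mem_image_iff_symm]
    rfl

end Ideals

section Actions

variable {G : Type v} [Group G] {A : Type u} [NonUnitalCStarAlgebra A]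

/-- Continuity of an action of a topological group: `g ↦ α_g(a)` is norm continuous for every
`a`. -/
def IsContinuousAction [TopologicalSpace G] (α : G →* (A ≃⋆ₐ[ℂ] A)) : Prop :=
  ∀ a : A, Continuous fun g : G => α g a

/-- An action is minimal if `0` and `A` are the only invariant closed ideals. -/
def IsMinimalAction (α : G →* (A ≃⋆ₐ[ℂ] A)) : Prop :=
  ∀ J : Submodule ℂ A, IsClosedIdeal J → (∀ g, ∀ x ∈ J, α g x ∈ J) → J = ⊥ ∨ J = ⊤

/-- The subgroup `H = {g ∈ G : Prim(α_g) = id}` of the elements acting trivially on `Prim(A)`. -/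
def primKernel (α : G →* (A ≃⋆ₐ[ℂ] A)) : Subgroup G where
  carrier := {g | Prim.map (α g) = id}
  one_mem' := by
    funext P
    rw [map_one]
    exact Prim.map_one P
  mul_mem' := by
    intro g h hg hh
    funext P
    rw [map_mul, Prim.map_mul, Set.mem_ofPred_eq.mp hg, Set.mem_ofPred_eq.mp hh]
    rfl
  inv_mem' := by
    intro g hg
    funext P
    have h := Prim.map_mul (α g⁻¹) (α g) P
    rw [← map_mul, inv_mul_cancel, map_one, Prim.map_one, Set.mem_ofPred_eq.mp hg] at h
    exact h.symm

end Actions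

end CStarMin

/-!
Let `P` be a primitive ideal of `A` with `P ≠ 0`, and suppose that `G ⧸ H` is compact. The
translates `α_g(P)` depend only on the class of `g` in `G ⧸ H`, and by norm continuity of the action
they contain, locally in this class, a common nonzero closed ideal
(`exists_nhds_isClosedIdeal_le_image`): if `b` is self-adjoint and at distance at most `m` from a
primitive ideal, then that ideal contains `(|b| - m)₊`, and this is nonzero as soon as `m < ‖b‖`.
Since `A` is prime, finite intersections of nonzero closed ideals are nonzero, so by compactness some
nonzero closed ideal lies in all translates of `P`. The intersection of the translates is then a
closed invariant ideal different from `0` and `A`, and the action is not minimal.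

It remains to find a nonzero primitive ideal when `A` is not simple, that is, to find for each
proper closed ideal `J` an irreducible representation that kills `J`
(`IsClosedIdeal.exists_isIrreducibleRep`). In the unitization, Hahn–Banach separation gives a state
that vanishes on `J` and not on a given positive `b` of `A` outside `J`
(`exists_mem_statesVanishingOn`); Krein–Milman makes it extreme among the states vanishing on `J`;
its GNS representation kills `J` and is irreducible (`gns_irreducible_of_extreme`). Quotient
C*-algebras are avoided by the order-theoretic membership criterion
`IsClosedIdeal.mem_of_forall_le`.
-/

namespace CStarMin

open scoped ComplexOrder InnerProductSpace

/-! ### States vanishing on a closed ideal -/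

section States

variable {B : Type u} [CStarAlgebra B]

/-- The states of `B` that vanish on `x* x` for all `x` in `I`; by the Cauchy–Schwarz inequality
these are the states that vanish on a closed ideal `I`. They are encoded as plain functions, so
that the topology of pointwise convergence on `B → ℂ` plays the role of the weak-* topology. -/
def statesVanishingOn (I : Submodule ℂ B) : Set (B → ℂ) :=
  {f | (∀ x y, f (x + y) = f x + f y) ∧ (∀ (c : ℂ) x, f (c • x) = c * f x) ∧
    (∀ x, 0 ≤ f (star x * x)) ∧ f 1 = 1 ∧ ∀ x ∈ I, f (star x * x) = 0}

theorem convex_statesVanishingOn (I : Submodule ℂ B) : Convex ℝ (statesVanishingOn I) := by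
  rintro f ⟨f1, f2, f3, f4, f5⟩ g ⟨g1, g2, g3, g4, g5⟩ s t hs ht hst
  refine ⟨fun x y => ?_, fun c x => ?_, fun x => ?_, ?_, fun x hx => ?_⟩ <;>
    simp only [Pi.add_apply, Pi.smul_apply]
  · rw [f1, g1, smul_add, smul_add, add_add_add_comm]
  · simp only [f2, g2, Complex.real_smul]; ring
  · exact add_nonneg (smul_nonneg hs (f3 x)) (smul_nonneg ht (g3 x))
  · rw [f4, g4, ← add_smul, hst, one_smul]
  · rw [f5 x hx, g5 x hx, smul_zero, smul_zero, add_zero]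

end States

section Unital

variable {B : Type u} [CStarAlgebra B] [PartialOrder B] [StarOrderedRing B]

/-- A positive element that is dominated, up to arbitrarily small multiples of the unit, by
self-adjoint elements of a closed ideal lies in the ideal. This is the separation hypothesis for the
Hahn–Banach argument, and it stands in for the C*-norm of the quotient by the ideal. -/
theorem IsClosedIdeal.mem_of_forall_le {I : Submodule ℂ B} (hI : IsClosedIdeal I) {b : B}
    (hb : 0 ≤ b)
    (h : ∀ ε : ℝ, 0 < ε → ∃ j ∈ I, IsSelfAdjoint j ∧ b ≤ j + algebraMap ℝ B ε) : b ∈ I := by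
  have key : ∀ c : ℝ, 0 < c → ∃ y ∈ I, ‖b - y‖ ≤ c := by
    intro c hc
    obtain ⟨j, hjI, hj, hbj⟩ := h (c / 2) (by positivity)
    -- Replace `j` by a positive element of `I`, using `t ≤ t² / c + c / 4` for real `t`.
    set k : B := c⁻¹ • (j * j) with hk
    have hkI : k ∈ I := (I.restrictScalars ℝ).smul_mem c⁻¹ (hI.mul_mem_left j hjI)
    have hk0 : 0 ≤ k := by
      have := star_mul_self_nonneg j
      rw [hj.star_eq] at this
      exact smul_nonneg (by positivity) this
    have hjk : j ≤ k + algebraMap ℝ B (c / 2) := by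
      have hs := star_mul_self_nonneg (j - algebraMap ℝ B (c / 2))
      rw [star_sub, hj.star_eq, (IsSelfAdjoint.algebraMap B (.all (c / 2))).star_eq] at hs
      have hs2 : 0 ≤ c⁻¹ • ((j - algebraMap ℝ B (c / 2)) * (j - algebraMap ℝ B (c / 2))) +
          algebraMap ℝ B (c / 4) :=
        add_nonneg (smul_nonneg (by positivity) hs)
          (algebraMap_nonneg B (by positivity))
      rw [← sub_nonneg]
      convert hs2 using 1
      simp only [hk, Algebra.algebraMap_eq_smul_one, sub_mul, mul_sub, smul_sub, smul_mul_assoc,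
        mul_smul_comm, mul_one, one_mul]
      match_scalars <;> field_simp <;> norm_num
    have hbk : b ≤ k + algebraMap ℝ B c := by
      calc b ≤ j + algebraMap ℝ B (c / 2) := hbj
        _ ≤ k + algebraMap ℝ B (c / 2) + algebraMap ℝ B (c / 2) := by gcongr
        _ = _ := by rw [add_assoc, ← map_add, add_halves]
    -- Compress `b` by `r = c (k + c)⁻¹`, for which `1 - r = (k + c)⁻¹ k` lies in `I`.
    let uc : Bˣ := Units.map (algebraMap ℝ B).toMonoidHom (Units.mk0 c hc.ne')
    have huc : (uc : B) = algebraMap ℝ B c := rfl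
    have huc' : ((uc⁻¹ : Bˣ) : B) = algebraMap ℝ B c⁻¹ := rfl
    have hc0 : 0 ≤ algebraMap ℝ B c := algebraMap_nonneg B hc.le
    have hcpos : IsStrictlyPositive (algebraMap ℝ B c) := ⟨hc0, uc.isUnit⟩
    obtain ⟨w, hw⟩ := (hcpos.nonneg_add hk0).isUnit
    have hle : ((w⁻¹ : Bˣ) : B) ≤ algebraMap ℝ B c⁻¹ := by
      rw [← huc']
      exact CStarAlgebra.inv_le_inv hc0 (by rw [huc, hw]; exact le_add_of_nonneg_left hk0)
    have hw0 : 0 ≤ (w : B) := by rw [hw]; exact add_nonneg hk0 hc0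
    have hwi0 : 0 ≤ ((w⁻¹ : Bˣ) : B) := CFC.inv_nonneg_of_nonneg w hw0
    set r : B := c • ((w⁻¹ : Bˣ) : B) with hr
    have hr0 : 0 ≤ r := smul_nonneg hc.le hwi0
    have hr1 : r ≤ 1 := by
      calc r ≤ c • algebraMap ℝ B c⁻¹ := by rw [hr]; gcongr
        _ = 1 := by rw [Algebra.algebraMap_eq_smul_one, smul_smul, mul_inv_cancel₀ hc.ne', one_smul]
    have hrs : IsSelfAdjoint r := .of_nonneg hr0
    have h1r : 1 - r ∈ I := by
      have : 1 - r = ((w⁻¹ : Bˣ) : B) * k := by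
        have e : k = (w : B) - c • (1 : B) := by
          rw [hw, Algebra.algebraMap_eq_smul_one]; abel
        rw [e, mul_sub, Units.inv_mul, mul_smul_comm, mul_one]
      rw [this]
      exact hI.mul_mem_left _ hkI
    refine ⟨b - r * b * r, ?_, ?_⟩
    · have : b - r * b * r = (1 - r) * b + r * b * (1 - r) := by noncomm_ring
      rw [this]
      exact I.add_mem (hI.mul_mem_right _ h1r) (hI.mul_mem_left _ h1r)
    · rw [sub_sub_cancel]
      have h1 : r * b * r ≤ algebraMap ℝ B c := by
        calc r * b * r ≤ r * (w : B) * r := by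
              rw [hw]; exact IsSelfAdjoint.conjugate_le_conjugate hbk hrs
          _ = c • r := by
              rw [hr]
              simp only [smul_mul_assoc, mul_smul_comm, Units.inv_mul, one_mul]
          _ ≤ c • 1 := by gcongr
          _ = _ := (Algebra.algebraMap_eq_smul_one c).symm
      exact (CStarAlgebra.norm_le_iff_le_algebraMap _ hc.le
        (by simpa [hrs.star_eq] using star_left_conjugate_nonneg hb r)).2 h1
  rw [← SetLike.mem_coe, ← hI.isClosed.closure_eq, Metric.mem_closure_iff]
  intro ε hε
  obtain ⟨y, hy, hy'⟩ := key (ε / 2) (by positivity)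
  exact ⟨y, hy, by rw [dist_eq_norm]; linarith⟩

/-- A linear functional that is nonnegative on all `x* x`, bundled as a positive linear map. -/
def toPositive (f : B →ₗ[ℂ] ℂ) (hf : ∀ x, 0 ≤ f (star x * x)) : B →ₚ[ℂ] ℂ where
  toLinearMap := f
  monotone' a b hab := by
    obtain ⟨x, hx⟩ := CStarAlgebra.nonneg_iff_eq_star_mul_self.1 (sub_nonneg.2 hab)
    have := hf x
    rw [← hx, map_sub] at this
    exact sub_nonneg.1 this

/-- Hahn–Banach separation of `-b` from the cone generated by the positive elements and `I`. -/
theorem exists_mem_statesVanishingOn {I : Submodule ℂ B} (hI : IsClosedIdeal I) {b : B}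
    (hb : 0 ≤ b) (hbI : b ∉ I) : ∃ f ∈ statesVanishingOn I, f b ≠ 0 := by
  -- The cone of all `x` whose real part is a positive element plus a self-adjoint element of `I`.
  let K : Set B := {x | ∃ p, 0 ≤ p ∧ ∃ j ∈ I, IsSelfAdjoint j ∧ x + star x = p + j}
  have hK0 : (0 : B) ∈ K := ⟨0, le_rfl, 0, I.zero_mem, .zero B, by simp⟩
  have hKsmul : ∀ t : ℝ, 0 ≤ t → ∀ x ∈ K, t • x ∈ K := by
    rintro t ht x ⟨p, hp, j, hj, hjs, e⟩
    exact ⟨t • p, smul_nonneg ht hp, t • j, (I.restrictScalars ℝ).smul_mem t hj,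
      (IsSelfAdjoint.all t).smul hjs, by rw [star_smul, star_trivial, ← smul_add, e, smul_add]⟩
  have hKadd : ∀ x ∈ K, ∀ y ∈ K, x + y ∈ K := by
    rintro x ⟨p, hp, j, hj, hjs, e⟩ y ⟨q, hq, i, hi, his, e'⟩
    refine ⟨p + q, add_nonneg hp hq, j + i, I.add_mem hj hi, hjs.add his, ?_⟩
    rw [star_add, add_add_add_comm, e, e', add_add_add_comm]
  have hKconv : Convex ℝ K := fun x hx y hy s t hs ht _ =>
    hKadd _ (hKsmul s hs x hx) _ (hKsmul t ht y hy)
  have hbK : -b ∉ closure K := by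
    intro hmem
    refine hbI (hI.mem_of_forall_le hb fun ε hε => ?_)
    obtain ⟨x, ⟨p, hp, j, hj, hjs, e⟩, hx⟩ := Metric.mem_closure_iff.1 hmem ε hε
    rw [dist_eq_norm] at hx
    set d : B := -b - x with hd
    have hbs : star b = b := (IsSelfAdjoint.of_nonneg hb).star_eq
    have hds : IsSelfAdjoint (-(d + star d)) := (IsSelfAdjoint.add_star_self d).neg
    have hdn : ‖-(d + star d)‖ ≤ 2 * ε := by
      rw [norm_neg]
      refine (norm_add_le _ _).trans ?_
      rw [norm_star]; linarith
    have h2 : -(d + star d) ≤ algebraMap ℝ B (2 * ε) :=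
      hds.le_algebraMap_norm_self.trans (algebraMap_mono B hdn)
    have h3 : -(d + star d) = (2 : ℝ) • b + (p + j) := by
      rw [← e, hd, star_sub, star_neg, hbs, two_smul]; abel
    refine ⟨(2 : ℝ)⁻¹ • (-j), (I.restrictScalars ℝ).smul_mem _ (I.neg_mem hj),
      (IsSelfAdjoint.all (2 : ℝ)⁻¹).smul hjs.neg, ?_⟩
    have h4 : (2 : ℝ) • b ≤ -j + algebraMap ℝ B (2 * ε) := by
      rw [h3] at h2
      have : (2 : ℝ) • b + j ≤ algebraMap ℝ B (2 * ε) :=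
        le_trans (by rw [add_comm p j, ← add_assoc]; exact le_add_of_nonneg_right hp) h2
      rw [neg_add_eq_sub]
      exact le_sub_iff_add_le.2 this
    have h5 := smul_le_smul_of_nonneg_left h4 (show (0 : ℝ) ≤ 2⁻¹ by norm_num)
    rw [smul_smul, inv_mul_cancel₀ two_ne_zero, one_smul] at h5
    refine h5.trans_eq ?_
    rw [Algebra.algebraMap_eq_smul_one, Algebra.algebraMap_eq_smul_one]
    module
  obtain ⟨φ, s, hs, hφ⟩ :=
    RCLike.geometric_hahn_banach_point_closed (𝕜 := ℂ) hKconv.closure isClosed_closure hbK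
  have hs0 : s < 0 := by simpa using hφ 0 (subset_closure hK0)
  have hφK : ∀ x ∈ K, 0 ≤ (φ x).re := by
    intro x hx
    by_contra! hneg
    have := hφ _ (subset_closure (hKsmul (s / (φ x).re) (div_nonneg_of_nonpos hs0.le hneg.le) x hx))
    rw [← Complex.coe_smul, map_smul] at this
    simp [div_mul_cancel₀ _ hneg.ne] at this
  -- `K` contains the skew-adjoint elements, so `φ` is real on the self-adjoint ones.
  have hφim : ∀ h : B, IsSelfAdjoint h → (φ h).im = 0 := by
    intro h hh
    have hmem : ∀ c : ℂ, star c = -c → c • h ∈ K := fun c hc =>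
      ⟨0, le_rfl, 0, I.zero_mem, .zero B, by rw [star_smul, hh.star_eq, hc]; simp⟩
    have h1 := hφK _ (hmem Complex.I (by simp))
    have h2 := hφK _ (hmem (-Complex.I) (by simp))
    simp at h1 h2
    linarith
  have hφpos : ∀ x, 0 ≤ φ (star x * x) := by
    intro x
    have hsa : IsSelfAdjoint (star x * x) := .star_mul_self x
    refine Complex.nonneg_iff.2 ⟨hφK _ ⟨star x * x + star x * x, ?_, 0, I.zero_mem, .zero B, ?_⟩,
      (hφim _ hsa).symm⟩
    · exact add_nonneg (star_mul_self_nonneg x) (star_mul_self_nonneg x)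
    · rw [hsa.star_eq, add_zero]
  have hφI : ∀ x ∈ I, φ (star x * x) = 0 := by
    intro x hx
    have hsa : IsSelfAdjoint (star x * x) := .star_mul_self x
    have hxI : star x * x ∈ I := hI.mul_mem_left _ hx
    have h1 := hφK (-(star x * x)) ⟨0, le_rfl, -(star x * x) + -(star x * x),
      I.add_mem (I.neg_mem hxI) (I.neg_mem hxI), hsa.neg.add hsa.neg, by
        rw [star_neg, hsa.star_eq, zero_add]⟩
    have h2 := (Complex.nonneg_iff.1 (hφpos x)).1
    rw [map_neg, Complex.neg_re] at h1
    exact Complex.ext (by simp; linarith) (hφim _ hsa)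
  have hφb : φ b ≠ 0 := by
    intro h0
    simp only [map_neg, h0] at hs
    simp at hs
    linarith
  have hφ1 : φ 1 ≠ 0 := by
    intro h0
    refine hφb (norm_le_zero_iff.1 ?_)
    have := (toPositive (φ : B →ₗ[ℂ] ℂ) hφpos).norm_apply_le_of_nonneg b hb
    change ‖φ b‖ ≤ ‖φ 1‖ * ‖b‖ at this
    simpa [h0] using this
  have hφ1' : 0 ≤ φ 1 := by simpa using hφpos 1
  refine ⟨fun x => (φ 1)⁻¹ * φ x, ⟨?_, ?_, ?_, ?_, ?_⟩, ?_⟩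
  · intro x y; simp only [map_add, mul_add]
  · intro c x; simp only [map_smul, smul_eq_mul]; ring
  · intro x; exact mul_nonneg (inv_nonneg.2 hφ1') (hφpos x)
  · exact inv_mul_cancel₀ hφ1
  · intro x hx; simp only [hφI x hx, mul_zero]
  · exact mul_ne_zero (inv_ne_zero hφ1) hφb

end Unital

/-! ### Extreme states and irreducibility of the GNS representation -/

section GNS

variable {B : Type u} [CStarAlgebra B] [PartialOrder B] [StarOrderedRing B]

/-- The cyclic vector of the GNS representation: the class of the unit. -/
noncomputable def gnsVector (f : B →ₚ[ℂ] ℂ) : f.GNS := (f.toPreGNS 1 : f.PreGNS)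

theorem gnsStarAlgHom_gnsVector (f : B →ₚ[ℂ] ℂ) (a : B) :
    f.gnsStarAlgHom a (gnsVector f) = (f.toPreGNS a : f.PreGNS) := by
  change f.gnsNonUnitalStarAlgHom a _ = _
  rw [gnsVector, PositiveLinearMap.gnsNonUnitalStarAlgHom_apply_coe]
  simp

theorem inner_gnsVector (f : B →ₚ[ℂ] ℂ) (a : B) :
    ⟪gnsVector f, f.gnsStarAlgHom a (gnsVector f)⟫_ℂ = f a := by
  rw [gnsStarAlgHom_gnsVector, gnsVector, UniformSpace.Completion.inner_coe,
    PositiveLinearMap.preGNS_inner_def]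
  simp

/-- The GNS vector is cyclic. -/
theorem eq_top_of_gns_mem (f : B →ₚ[ℂ] ℂ) {M : Submodule ℂ f.GNS} (hM : IsClosed (M : Set f.GNS))
    (h : ∀ a, f.gnsStarAlgHom a (gnsVector f) ∈ M) : M = ⊤ := by
  refine Submodule.eq_top_iff'.2 fun x => ?_
  induction x using UniformSpace.Completion.induction_on with
  | hp => exact hM
  | ih y =>
    have := h (f.ofPreGNS y)
    rwa [gnsStarAlgHom_gnsVector, PositiveLinearMap.toPreGNS_ofPreGNS] at this

/-- Cyclicity of the GNS vector, in terms of inner products. -/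
theorem eq_zero_of_gns_inner (f : B →ₚ[ℂ] ℂ) {x : f.GNS}
    (h : ∀ a, ⟪x, f.gnsStarAlgHom a (gnsVector f)⟫_ℂ = 0) : x = 0 := by
  have : (ℂ ∙ x)ᗮ = ⊤ := eq_top_of_gns_mem f (Submodule.isClosed_orthogonal _) fun a =>
    Submodule.mem_orthogonal_singleton_iff_inner_right.2 (h a)
  have hx : x ∈ (ℂ ∙ x)ᗮ := this ▸ Submodule.mem_top
  exact inner_self_eq_zero.1 (Submodule.mem_orthogonal_singleton_iff_inner_right.1 hx)

theorem inner_self_eq_coe {E : Type*} [NormedAddCommGroup E] [InnerProductSpace ℂ E] (x : E) :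
    ⟪x, x⟫_ℂ = ((‖x‖ ^ 2 : ℝ) : ℂ) := by
  rw [inner_self_eq_norm_sq_to_K, RCLike.ofReal_eq_complex_ofReal, Complex.ofReal_pow]

theorem norm_le_of_positive (f : B →ₚ[ℂ] ℂ) (hf : f 1 = 1) (a : B) : ‖f a‖ ≤ ‖a‖ := by
  have hξ : ‖gnsVector f‖ = 1 := by
    have := inner_gnsVector f 1
    rw [map_one, one_apply_eq_self, hf, inner_self_eq_coe] at this
    have h2 : ‖gnsVector f‖ ^ 2 = 1 := by exact_mod_cast this
    nlinarith [norm_nonneg (gnsVector f)]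
  rw [← inner_gnsVector f a]
  refine (norm_inner_le_norm _ _).trans ?_
  rw [hξ, one_mul]
  refine (ContinuousLinearMap.le_opNorm _ _).trans ?_
  rw [hξ, mul_one]
  exact NonUnitalStarAlgHom.norm_apply_le f.gnsStarAlgHom a

theorem isCompact_statesVanishingOn (I : Submodule ℂ B) : IsCompact (statesVanishingOn I) := by
  refine (isCompact_univ_pi fun a : B => isCompact_closedBall (0 : ℂ) ‖a‖).of_isClosed_subset ?_ ?_
  · simp only [statesVanishingOn, Set.ofPred_and, Set.ofPred_forall]
    refine .inter ?_ (.inter ?_ (.inter ?_ (.inter ?_ ?_)))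
    · exact isClosed_iInter fun x => isClosed_iInter fun y => isClosed_eq (by fun_prop) (by fun_prop)
    · exact isClosed_iInter fun c => isClosed_iInter fun x => isClosed_eq (by fun_prop) (by fun_prop)
    · exact isClosed_iInter fun x => isClosed_le (by fun_prop) (by fun_prop)
    · exact isClosed_eq (by fun_prop) (by fun_prop)
    · exact isClosed_iInter fun x => isClosed_iInter fun _ => isClosed_eq (by fun_prop) (by fun_prop)
  · rintro f ⟨h1, h2, h3, h4, -⟩ a -
    rw [mem_closedBall_zero_iff]
    exact norm_le_of_positive (toPositive ⟨⟨f, h1⟩, h2⟩ h3) h4 a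

/-- Krein–Milman: a compact convex set of states that contains one with `f b ≠ 0` has an extreme
point with this property. -/
theorem exists_mem_extremePoints_statesVanishingOn {I : Submodule ℂ B} (hI : IsClosedIdeal I)
    {b : B} (hb : 0 ≤ b) (hbI : b ∉ I) :
    ∃ f ∈ (statesVanishingOn I).extremePoints ℝ, f b ≠ 0 := by
  obtain ⟨f, hf, hfb⟩ := exists_mem_statesVanishingOn hI hb hbI
  by_contra! h
  refine hfb ?_
  have hV : IsClosed {g : B → ℂ | g b = 0} := isClosed_eq (by fun_prop) (by fun_prop)
  have hVc : Convex ℝ {g : B → ℂ | g b = 0} := by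
    intro g hg k hk s t _ _ _
    simp only [Set.mem_ofPred_eq] at hg hk
    simp [hg, hk]
  have hsub := closure_minimal (convexHull_min (fun g hg => h g hg) hVc) hV
  rw [closure_convexHull_extremePoints (isCompact_statesVanishingOn I)
    (convex_statesVanishingOn I)] at hsub
  exact hsub hf

theorem gns_eq_zero_of_mem {I : Submodule ℂ B} (hI : IsClosedIdeal I) (f : B →ₚ[ℂ] ℂ)
    (hf : ∀ x ∈ I, f (star x * x) = 0) {x : B} (hx : x ∈ I) : f.gnsStarAlgHom x = 0 := by
  ext y
  induction y using UniformSpace.Completion.induction_on with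
  | hp => exact isClosed_eq (by fun_prop) (by fun_prop)
  | ih y =>
    change f.gnsNonUnitalStarAlgHom x _ = 0
    rw [PositiveLinearMap.gnsNonUnitalStarAlgHom_apply_coe, ← norm_eq_zero,
      UniformSpace.Completion.norm_coe, PositiveLinearMap.preGNS_norm_def]
    simp only [PositiveLinearMap.leftMulMapPreGNS_apply, PositiveLinearMap.ofPreGNS_toPreGNS]
    rw [hf _ (hI.mul_mem_right (f.ofPreGNS y) hx), Complex.zero_re, Real.sqrt_zero]

/-- The normalized vector functionals of a representation that kills `I` are states of the kind
considered. -/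
theorem vectorState_mem {I : Submodule ℂ B} {E : Type*} [NormedAddCommGroup E]
    [InnerProductSpace ℂ E] [CompleteSpace E] (π : B →⋆ₐ[ℂ] (E →L[ℂ] E))
    (hπ : ∀ x ∈ I, π x = 0) {η : E} (hη : η ≠ 0) :
    (fun a => ((‖η‖ ^ 2)⁻¹ : ℝ) • ⟪η, π a η⟫_ℂ) ∈ statesVanishingOn I := by
  have hsq : ∀ x, ⟪η, π (star x * x) η⟫_ℂ = ((‖π x η‖ ^ 2 : ℝ) : ℂ) := by
    intro x
    rw [map_mul, map_star, mul_apply_eq_comp, ContinuousLinearMap.star_eq_adjoint,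
      ContinuousLinearMap.adjoint_inner_right, inner_self_eq_coe]
  have hη' : ‖η‖ ^ 2 ≠ 0 := by simpa using hη
  refine ⟨fun x y => ?_, fun c x => ?_, fun x => ?_, ?_, fun x hx => ?_⟩
  · simp
  · simp; ring
  · simp only [hsq]
    exact smul_nonneg (by positivity) (Complex.zero_le_real.2 (sq_nonneg _))
  · have := hsq 1
    rw [star_one, mul_one, map_one, one_apply_eq_self] at this
    simp only [map_one, one_apply_eq_self, Complex.real_smul]
    rw [this, ← Complex.ofReal_mul, inv_mul_cancel₀ hη', Complex.ofReal_one]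
  · simp [hπ x hx]

/-- The GNS representation of an extreme state is irreducible: the components of the cyclic vector
in an invariant subspace and in its orthogonal complement express the state as a convex combination
of two vector states. If both components are nonzero, extremality makes the first one a nonzero
multiple of the cyclic vector, so that the subspace is everything. -/
theorem gns_irreducible_of_extreme {I : Submodule ℂ B} (hI : IsClosedIdeal I) (f : B →ₚ[ℂ] ℂ)
    (hf : (f : B → ℂ) ∈ (statesVanishingOn I).extremePoints ℝ) (M : Submodule ℂ f.GNS)
    (hM : IsClosed (M : Set f.GNS)) (hinv : ∀ a, ∀ x ∈ M, f.gnsStarAlgHom a x ∈ M) :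
    M = ⊥ ∨ M = ⊤ := by
  set π := f.gnsStarAlgHom with hπ
  set ξ := gnsVector f with hξ
  obtain ⟨⟨-, -, -, hf1, hfI⟩, hext⟩ := mem_extremePoints.1 hf
  have hπI : ∀ x ∈ I, π x = 0 := fun x hx => gns_eq_zero_of_mem hI f hfI hx
  have hinv' : ∀ a, ∀ x ∈ Mᗮ, π a x ∈ Mᗮ := by
    intro a x hx
    refine (Submodule.mem_orthogonal _ _).2 fun y hy => ?_
    have := (Submodule.mem_orthogonal _ _).1 hx _ (hinv (star a) y hy)
    rwa [map_star, ContinuousLinearMap.star_eq_adjoint,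
      ContinuousLinearMap.adjoint_inner_left] at this
  have : CompleteSpace M := hM.completeSpace_coe
  obtain ⟨η, hη, ζ, hζ, hsum⟩ := M.exists_add_mem_mem_orthogonal ξ
  have htop : ξ ∈ M → M = ⊤ := fun h => eq_top_of_gns_mem f hM fun a => hinv a _ h
  rcases eq_or_ne η 0 with hη0 | hη0
  · left
    have : Mᗮ = ⊤ := eq_top_of_gns_mem f (Submodule.isClosed_orthogonal _) fun a =>
      hinv' a _ (by rw [← hξ, hsum, hη0, zero_add]; exact hζ)
    exact (Submodule.orthogonal_eq_top_iff M).1 this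
  right
  rcases eq_or_ne ζ 0 with hζ0 | hζ0
  · exact htop (by rw [hsum, hζ0, add_zero]; exact hη)
  have hηζ : ∀ a, ⟪η, π a ζ⟫_ℂ = 0 := fun a =>
    Submodule.inner_right_of_mem_orthogonal hη (hinv' a _ hζ)
  have hζη : ∀ a, ⟪ζ, π a η⟫_ℂ = 0 := fun a =>
    Submodule.inner_left_of_mem_orthogonal (hinv a _ hη) hζ
  have hdec : ∀ a, f a = ⟪η, π a η⟫_ℂ + ⟪ζ, π a ζ⟫_ℂ := by
    intro a
    rw [← inner_gnsVector f a, ← hξ, hsum, map_add, inner_add_left, inner_add_right,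
      inner_add_right, hηζ, hζη, add_zero, zero_add]
  have hnorm : ‖η‖ ^ 2 + ‖ζ‖ ^ 2 = 1 := by
    have := hdec 1
    rw [hf1, map_one, one_apply_eq_self, one_apply_eq_self,
      inner_self_eq_coe, inner_self_eq_coe] at this
    exact_mod_cast this.symm
  have hη2 : 0 < ‖η‖ ^ 2 := by positivity
  have hζ2 : 0 < ‖ζ‖ ^ 2 := by positivity
  have heq := (hext _ (vectorState_mem π hπI hη0) _ (vectorState_mem π hπI hζ0)
    ⟨‖η‖ ^ 2, ‖ζ‖ ^ 2, hη2, hζ2, hnorm, by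
      funext a
      simp only [Pi.add_apply, Pi.smul_apply, smul_smul, mul_inv_cancel₀ hη2.ne',
        mul_inv_cancel₀ hζ2.ne', one_smul]
      exact (hdec a).symm⟩).1
  have hscal : η = ((‖η‖ ^ 2 : ℝ) : ℂ) • ξ := by
    rw [← sub_eq_zero]
    refine eq_zero_of_gns_inner f fun a => ?_
    have h1 : ⟪η, π a ξ⟫_ℂ = ⟪η, π a η⟫_ℂ := by
      rw [hsum, map_add, inner_add_right, hηζ, add_zero]
    have h2 := congrFun heq a
    simp only [← inner_gnsVector f a] at h2
    rw [inner_sub_left, inner_smul_left, Complex.conj_ofReal, ← h2, ← hξ, ← hπ, h1,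
      Complex.real_smul, ← mul_assoc, ← Complex.ofReal_mul, mul_inv_cancel₀ hη2.ne',
      Complex.ofReal_one, one_mul, sub_self]
  refine htop ?_
  have h3 : ((‖η‖ ^ 2 : ℝ) : ℂ) ≠ 0 := by exact_mod_cast hη2.ne'
  exact (M.smul_mem_iff h3).1 (hscal ▸ hη)

end GNS

/-! ### Irreducible representations killing an ideal -/

section Existence

variable {A : Type u} [NonUnitalCStarAlgebra A]

/-- A closed ideal of `A` is a closed ideal of the unitization of `A`. -/
theorem IsClosedIdeal.map_inr {J : Submodule ℂ A} (hJ : IsClosedIdeal J) :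
    IsClosedIdeal (J.map (Unitization.inrHom ℂ ℂ A)) where
  mul_mem_left a := by
    rintro _ ⟨x, hx, rfl⟩
    refine ⟨a.fst • x + a.snd * x, J.add_mem (J.smul_mem _ hx) (hJ.mul_mem_left _ hx), ?_⟩
    ext <;> simp
  mul_mem_right a := by
    rintro _ ⟨x, hx, rfl⟩
    refine ⟨a.fst • x + x * a.snd, J.add_mem (J.smul_mem _ hx) (hJ.mul_mem_right _ hx), ?_⟩
    ext <;> simp
  isClosed :=
    (Unitization.isometry_inr (𝕜 := ℂ) (A := A)).isClosedEmbedding.isClosedMap _ hJ.isClosed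

/-- Every proper closed ideal is killed by some irreducible representation. -/
theorem IsClosedIdeal.exists_isIrreducibleRep {J : Submodule ℂ A} (hJ : IsClosedIdeal J)
    (hJtop : J ≠ ⊤) :
    ∃ (E : Type u) (_ : NormedAddCommGroup E) (_ : InnerProductSpace ℂ E) (_ : CompleteSpace E)
      (π : A →⋆ₙₐ[ℂ] (E →L[ℂ] E)), IsIrreducibleRep π ∧ ∀ x ∈ J, π x = 0 := by
  let _ : PartialOrder A := CStarAlgebra.spectralOrder A
  have : StarOrderedRing A := CStarAlgebra.spectralOrderedRing A
  obtain ⟨b, hb, hbJ⟩ : ∃ b : A, 0 ≤ b ∧ b ∉ J := by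
    by_contra! h
    exact hJtop (top_le_iff.1 (CStarAlgebra.span_nonneg (A := A) ▸ Submodule.span_le.2 h))
  have hbI : (b : Unitization ℂ A) ∉ J.map (Unitization.inrHom ℂ ℂ A) := by
    rintro ⟨x, hx, hxb⟩
    exact hbJ (Unitization.inr_injective hxb ▸ hx)
  obtain ⟨f, hf, hfb⟩ := exists_mem_extremePoints_statesVanishingOn hJ.map_inr
    (Unitization.inr_nonneg_iff.2 hb) hbI
  obtain ⟨h1, h2, h3, h4, h5⟩ := hf.1
  let F : Unitization ℂ A →ₚ[ℂ] ℂ := toPositive ⟨⟨f, h1⟩, h2⟩ h3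
  let inr := Unitization.inrNonUnitalStarAlgHom ℂ A
  have hinr : ∀ a, F.gnsNonUnitalStarAlgHom.comp inr a = F.gnsStarAlgHom (a : Unitization ℂ A) :=
    fun _ => rfl
  refine ⟨F.GNS, inferInstance, inferInstance, inferInstance,
    F.gnsNonUnitalStarAlgHom.comp inr, ⟨⟨b, ?_⟩, ?_⟩, ?_⟩
  · intro h0
    refine hfb ?_
    have := inner_gnsVector F (b : Unitization ℂ A)
    rw [← hinr, h0, zero_apply, inner_zero_right] at this
    exact this.symm
  · intro K hK hinv
    refine gns_irreducible_of_extreme hJ.map_inr F hf K hK fun a x hx => ?_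
    rw [← Unitization.inl_fst_add_inr_snd_eq a, map_add, add_apply]
    -- The unitization acts through `A` and the scalars, so both have the same invariant subspaces.
    refine K.add_mem ?_ (hinv a.snd x hx)
    rw [← Unitization.algebraMap_eq_inl, AlgHomClass.commutes, Algebra.algebraMap_eq_smul_one]
    exact K.smul_mem _ hx
  · intro x hx
    rw [hinr]
    exact gns_eq_zero_of_mem hJ.map_inr F h5 ⟨x, hx, rfl⟩

end Existence

/-! ### Cutting down self-adjoint elements -/

section CutDown

open scoped CStarAlgebra

variable {A : Type u} [NonUnitalCStarAlgebra A]

/-- The element `(|b| - m)₊` of the continuous functional calculus of a self-adjoint `b`. It is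
meaningful for `0 ≤ m`, when the function `t ↦ (|t| - m)₊` vanishes at `0`. -/
noncomputable def cutDown (m : ℝ) (b : A) : A := cfcₙ (fun t : ℝ => max 0 (|t| - m)) b

theorem cutDown_eq_zero_iff {m : ℝ} (hm : 0 ≤ m) {b : A} (hb : IsSelfAdjoint b) :
    cutDown m b = 0 ↔ ‖b‖ ≤ m := by
  have hc : ContinuousOn (fun t : ℝ => max 0 (|t| - m)) (quasispectrum ℝ b) := by fun_prop
  constructor
  · intro h
    rw [← cfcₙ_id ℝ b]
    refine norm_cfcₙ_le fun x hx => ?_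
    have := norm_apply_le_norm_cfcₙ (fun t : ℝ => max 0 (|t| - m)) b hx hc (by simpa using hm)
    rw [show cfcₙ (fun t : ℝ => max 0 (|t| - m)) b = 0 from h, norm_zero, norm_le_zero_iff] at this
    have := max_eq_left_iff.1 this
    simpa using this
  · intro h
    rw [cutDown, ← cfcₙ_zero ℝ b]
    refine cfcₙ_congr fun x hx => ?_
    have := norm_apply_le_norm_cfcₙ (id : ℝ → ℝ) b hx
    rw [cfcₙ_id ℝ b] at this
    have : |x| ≤ m := this.trans h
    simpa using this

theorem map_cutDown {B : Type*} [NonUnitalCStarAlgebra B] (φ : A →⋆ₙₐ[ℂ] B) {m : ℝ} (hm : 0 ≤ m)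
    {b : A} (hb : IsSelfAdjoint b) : φ (cutDown m b) = cutDown m (φ b) :=
  NonUnitalStarAlgHomClass.map_cfcₙ (S := ℂ) φ _ b (by fun_prop) (by simpa using hm)
    (map_continuous φ) hb (hb.map φ)

end CutDown

/-! ### Minimal actions -/

section Action

open scoped CStarAlgebra

variable {G : Type v} [Group G] {A : Type u} [NonUnitalCStarAlgebra A]

theorem IsClosedIdeal.iInf {ι : Sort*} {J : ι → Submodule ℂ A} (hJ : ∀ i, IsClosedIdeal (J i)) :
    IsClosedIdeal (⨅ i, J i) where
  mul_mem_left a x hx := by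
    rw [Submodule.mem_iInf] at hx ⊢
    exact fun i => (hJ i).mul_mem_left a (hx i)
  mul_mem_right a x hx := by
    rw [Submodule.mem_iInf] at hx ⊢
    exact fun i => (hJ i).mul_mem_right a (hx i)
  isClosed := by
    rw [Submodule.coe_iInf]
    exact isClosed_iInter fun i => (hJ i).isClosed

theorem IsClosedIdeal.inf {I J : Submodule ℂ A} (hI : IsClosedIdeal I) (hJ : IsClosedIdeal J) :
    IsClosedIdeal (I ⊓ J) where
  mul_mem_left a _ hx := ⟨hI.mul_mem_left a hx.1, hJ.mul_mem_left a hx.2⟩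
  mul_mem_right a _ hx := ⟨hI.mul_mem_right a hx.1, hJ.mul_mem_right a hx.2⟩
  isClosed := hI.isClosed.inter hJ.isClosed

theorem isClosedIdeal_top : IsClosedIdeal (⊤ : Submodule ℂ A) where
  mul_mem_left _ _ _ := trivial
  mul_mem_right _ _ _ := trivial
  isClosed := isClosed_univ

theorem IsPrimeCStar.inf_ne_bot (hA : IsPrimeCStar A) {I J : Submodule ℂ A}
    (hI : IsClosedIdeal I) (hJ : IsClosedIdeal J) (hI0 : I ≠ ⊥) (hJ0 : J ≠ ⊥) : I ⊓ J ≠ ⊥ := by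
  intro h
  refine (hA.eq_bot_or_eq_bot I J hI hJ fun x hx y hy => ?_).elim hI0 hJ0
  rw [← Submodule.mem_bot ℂ, ← h]
  exact ⟨hI.mul_mem_right y hx, hJ.mul_mem_left x hy⟩

theorem IsPrimitiveIdeal.isClosedIdeal {P : Submodule ℂ A} (hP : IsPrimitiveIdeal P) :
    IsClosedIdeal P := by
  obtain ⟨E, i₁, i₂, i₃, π, -, hker⟩ := hP
  refine ⟨fun a x hx => ?_, fun a x hx => ?_, ?_⟩
  · rw [hker] at hx ⊢; rw [map_mul, hx, mul_zero]
  · rw [hker] at hx ⊢; rw [map_mul, hx, zero_mul]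
  · have : (P : Set A) = π ⁻¹' {0} := Set.ext hker
    rw [this]
    exact isClosed_singleton.preimage (map_continuous π)

theorem IsPrimitiveIdeal.ne_top {P : Submodule ℂ A} (hP : IsPrimitiveIdeal P) : P ≠ ⊤ := by
  obtain ⟨E, i₁, i₂, i₃, π, hπ, hker⟩ := hP
  rintro rfl
  obtain ⟨a, ha⟩ := hπ.ne_zero
  exact ha ((hker a).1 trivial)

theorem IsClosedIdeal.exists_isPrimitiveIdeal_le {J : Submodule ℂ A} (hJ : IsClosedIdeal J)
    (hJtop : J ≠ ⊤) : ∃ P, IsPrimitiveIdeal P ∧ J ≤ P := by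
  obtain ⟨E, i₁, i₂, i₃, π, hπ, hker⟩ := hJ.exists_isIrreducibleRep hJtop
  exact ⟨LinearMap.ker (π : A →ₗ[ℂ] (E →L[ℂ] E)), ⟨E, i₁, i₂, i₃, π, hπ, fun _ => Iff.rfl⟩, hker⟩

/-- If a self-adjoint `b` is within distance `m` of a primitive ideal, then `(|b| - m)₊` lies in that
ideal, because the norm of `b` in the associated representation is at most `m`. -/
theorem IsPrimitiveIdeal.cutDown_mem {P : Submodule ℂ A} (hP : IsPrimitiveIdeal P) {b c : A}
    (hb : IsSelfAdjoint b) (hc : c ∈ P) {m : ℝ} (hbc : ‖b - c‖ ≤ m) : cutDown m b ∈ P := by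
  obtain ⟨E, i₁, i₂, i₃, π, -, hker⟩ := hP
  have hm : 0 ≤ m := (norm_nonneg _).trans hbc
  rw [hker, map_cutDown π hm hb, cutDown_eq_zero_iff hm (hb.map π)]
  have : π b = π (b - c) := by rw [map_sub, (hker c).1 hc, sub_zero]
  rw [this]
  exact (NonUnitalStarAlgHom.norm_apply_le π _).trans hbc

/-- The translate `α_g(P)` of a primitive ideal depends only on the class of `g` in `G ⧸ H`. -/
theorem image_eq_of_mk_eq (α : G →* (A ≃⋆ₐ[ℂ] A)) {P : Submodule ℂ A} (hP : IsPrimitiveIdeal P)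
    {g k : G} (h : (g : G ⧸ primKernel α) = k) : image (α g) P = image (α k) P := by
  have hmem : Prim.map (α (g⁻¹ * k)) = id := QuotientGroup.eq.1 h
  let Q : Prim A := ⟨P, hP⟩
  have h2 : Prim.map (α k) Q = Prim.map (α g) Q := by
    rw [show k = g * (g⁻¹ * k) by group, map_mul, Prim.map_mul, hmem]
    rfl
  exact (congrArg Subtype.val h2).symm

/-- Locally on `G ⧸ H`, the translates of a nonzero primitive ideal contain a common nonzero closed
ideal: for `g` close to `k`, the element `b = α_k(b₀)` with `b₀` in `P` is close to `α_g(b₀)`, hence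
to `α_g(P)`, so that a fixed nonzero cut-down of `b` lies in `α_g(P)`. -/
theorem exists_nhds_isClosedIdeal_le_image [TopologicalSpace G] [IsTopologicalGroup G]
    {α : G →* (A ≃⋆ₐ[ℂ] A)} (hα : IsContinuousAction α) {P : Submodule ℂ A}
    (hP : IsPrimitiveIdeal P) (hP0 : P ≠ ⊥) (q : G ⧸ primKernel α) :
    ∃ t ∈ 𝓝 q, ∃ I : Submodule ℂ A, IsClosedIdeal I ∧ I ≠ ⊥ ∧
      ∀ g : G, (g : G ⧸ primKernel α) ∈ t → I ≤ image (α g) P := by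
  obtain ⟨k, rfl⟩ := QuotientGroup.mk_surjective q
  obtain ⟨a, haP, ha0⟩ := P.exists_mem_ne_zero_of_ne_bot hP0
  set b₀ := star a * a with hb₀
  have hb₀P : b₀ ∈ P := hP.isClosedIdeal.mul_mem_left _ haP
  set b := α k b₀ with hb
  have hbs : IsSelfAdjoint b := (IsSelfAdjoint.star_mul_self a).map (α k)
  have hb0 : b ≠ 0 :=
    (map_ne_zero_iff (α k) (EquivLike.injective (α k))).2 (by simpa [hb₀] using ha0)
  have hm : 0 < ‖b‖ / 2 := half_pos (norm_pos_iff.2 hb0)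
  let V : Set G := {g | ‖b - α g b₀‖ < ‖b‖ / 2}
  have hV : IsOpen V := isOpen_lt (continuous_const.sub (hα b₀)).norm continuous_const
  have hkV : k ∈ V := by simpa [V, ← hb] using hb0
  refine ⟨QuotientGroup.mk '' V, (QuotientGroup.isOpenMap_coe _ hV).mem_nhds ⟨k, hkV, rfl⟩,
    ⨅ g : V, image (α g) P, .iInf fun g => (hP.image _).isClosedIdeal, ?_, ?_⟩
  · intro h
    have hmem : cutDown (‖b‖ / 2) b ∈ ⨅ g : V, image (α g) P :=
      (Submodule.mem_iInf _).2 fun g =>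
        (hP.image _).cutDown_mem hbs ⟨b₀, hb₀P, rfl⟩ g.2.le
    rw [h, Submodule.mem_bot, cutDown_eq_zero_iff hm.le hbs] at hmem
    linarith
  · rintro g ⟨g', hg', h⟩
    rw [← image_eq_of_mk_eq α hP h]
    exact iInf_le (fun g : V => image (α g) P) ⟨g', hg'⟩

theorem IsPrimeCStar.isSimpleCStar_of_isMinimalAction [TopologicalSpace G] [IsTopologicalGroup G]
    (hA : IsPrimeCStar A) {α : G →* (A ≃⋆ₐ[ℂ] A)} (hα : IsContinuousAction α)
    (hmin : IsMinimalAction α) [CompactSpace (G ⧸ primKernel α)] : IsSimpleCStar A := by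
  have := hA.nontrivial
  refine ⟨this, fun J hJ => ?_⟩
  by_contra! hne
  obtain ⟨P, hP, hJP⟩ := hJ.exists_isPrimitiveIdeal_le hne.2
  have hP0 : P ≠ ⊥ := fun h => hne.1 (le_bot_iff.1 (h ▸ hJP))
  -- By compactness and primeness, the local ideals combine to one below all translates of `P`.
  obtain ⟨I, -, hI0, hIP⟩ := isCompact_univ.induction_on
    (p := fun t : Set (G ⧸ primKernel α) => ∃ I : Submodule ℂ A, IsClosedIdeal I ∧ I ≠ ⊥ ∧
      ∀ g : G, (g : G ⧸ primKernel α) ∈ t → I ≤ image (α g) P)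
    ⟨⊤, isClosedIdeal_top, top_ne_bot, fun _ h => h.elim⟩
    (fun s t hst ⟨I, hI, hI0, h⟩ => ⟨I, hI, hI0, fun g hg => h g (hst hg)⟩)
    (fun s t ⟨I, hI, hI0, h⟩ ⟨I', hI', hI'0, h'⟩ => ⟨I ⊓ I', hI.inf hI',
      hA.inf_ne_bot hI hI' hI0 hI'0, fun g hg => hg.elim
        (fun hg => inf_le_left.trans (h g hg)) fun hg => inf_le_right.trans (h' g hg)⟩)
    (fun q _ => by
      simpa only [nhdsWithin_univ] using exists_nhds_isClosedIdeal_le_image hα hP hP0 q)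
  have hIle : I ≤ ⨅ g, image (α g) P := le_iInf fun g => hIP g (Set.mem_univ _)
  have hinv : ∀ g, ∀ x ∈ ⨅ g, image (α g) P, α g x ∈ ⨅ g, image (α g) P := by
    intro g x hx
    rw [Submodule.mem_iInf] at hx ⊢
    intro k
    obtain ⟨y, hy, hyx⟩ := hx (g⁻¹ * k)
    refine ⟨y, hy, ?_⟩
    rw [← hyx, ← StarAlgEquiv.mul_apply, ← map_mul, mul_inv_cancel_left]
  rcases hmin _ (.iInf fun g => (hP.image _).isClosedIdeal) hinv with h | h
  · exact hI0 (le_bot_iff.1 (h ▸ hIle))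
  · exact (hP.image (α 1)).ne_top (top_le_iff.1 (h ▸ iInf_le _ 1))

end Action

end CStarMin

theorem corollaryC {G : Type v} [Group G] [TopologicalSpace G] [IsTopologicalGroup G] [T2Space G]
    {A : Type u} [NonUnitalCStarAlgebra A] [TopologicalSpace.SeparableSpace A]
    (hA : CStarMin.IsPrimeCStar A) :
    (∀ α : G →* (A ≃⋆ₐ[ℂ] A), CStarMin.IsContinuousAction α → CStarMin.IsMinimalAction α →
      CompactSpace (G ⧸ CStarMin.primKernel α) → CStarMin.IsSimpleCStar A) ∧
    (CompactSpace G → ¬ CStarMin.IsSimpleCStar A →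
      ¬ ∃ α : G →* (A ≃⋆ₐ[ℂ] A), CStarMin.IsContinuousAction α ∧ CStarMin.IsMinimalAction α) := by
  refine ⟨fun α hα hmin _ => hA.isSimpleCStar_of_isMinimalAction hα hmin, ?_⟩
  rintro _ hns ⟨α, hα, hmin⟩
  exact hns (hA.isSimpleCStar_of_isMinimalAction hα hmin)
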